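/- For integers $n\ge r\ge 1$ and $d\ge 1$ let $\binom{[n]}{r}\subset\{0,1\}^n$ be the set of binary sequences with exactly $r$ ones, let $X^n$ be uniformly distributed on it, let $\{0,1\}^*=\{0,1,00,01,10,\dots\}$ be the set of finite nonempty binary strings, and let $\ell(b)$ be the length of $b\in\{0,1\}^*$. An $(r,d,n)$-locally decodable code (or $(r,d,n)$ code) is a map $\mathsf c:\binom{[n]}{r}\to\{0,1\}^*$ for which there is a decoder that, given any index $j\in[n]$ and the length $\ell(\mathsf c(x^n))$, determines $x_j$ by probing at most $d$ bits of $\mathsf c(x^n)$, for every $x^n\in\binom{[n]}{r}$. The code is non-adaptive if the probed positions depend only on $j$ and $\ell(\mathsf c(x^n))$; for an adaptive code they may also depend on the values of the bits probed before. A code is optimal (among adaptive codes, or among non-adaptive codes) if its expected length $\mathbb E[\ell(\mathsf c(X^n))]$ is the least possible among the $(r,d,n)$ codes of that class. Let $r_n,d_n$ be integers with $1\le r_n\le n$ and $d_n\ge 1$ for all large $n$, and suppose that, as $n\to\infty$, $\log_2\binom{n}{r_n}=\Omega(r_nd_n)$ and $d_n=\Omega(\log_2 r_n)$. Then every sequence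 $\{\mathsf c_n^\star\}$ of optimal $(r_n,d_n,n)$ codes, whether the optimum is taken among adaptive or among non-adaptive codes, satisfies $$\mathbb E\big[\ell(\mathsf c_n^\star(X^n))\big]=\Theta\Big(r_nd_n\binom{n}{r_n}^{1/(r_nd_n+1)}\Big)\qquad(n\to\infty).$$ -/

import Mathlib

open Filter Asymptotics

namespace LocDec

/-- The `r`-sparse source sequences: binary sequences of length `n` with exactly `r` ones. -/
abbrev SparseVec (n r : ℕ) : Type :=
  {x : Fin n → Bool // (Finset.univ.filter fun i => x i = true).card = r}

/-- Codewords: the set `{0, 1, 00, 01, 10, …}` of (nonempty) finite binary strings. -/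
abbrev Codeword : Type := {w : List Bool // w ≠ []}

/-- The length of a codeword. -/
def Codeword.len (w : Codeword) : ℕ := w.1.length

/-- The bit stored at a position (positions are numbered from `0`). A position beyond the end of
the codeword always reads `false`, so that it gives no information besides the length. -/
def Codeword.bit (w : Codeword) (i : ℕ) : Bool := w.1.getD i false

/-- Adaptive probing strategies (binary decision trees): either output a bit, or probe a position
and continue with the first subtree if the bit read is `0` and with the second if it is `1`. -/
inductive ProbeTree : Type
  | output (b : Bool) : ProbeTree
  | probe (i : ℕ) (onZero onOne : ProbeTree) : ProbeTree

/-- The number of probes in the worst case. -/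
def ProbeTree.depth : ProbeTree → ℕ
  | .output _ => 0
  | .probe _ t₀ t₁ => max t₀.depth t₁.depth + 1

/-- The bit that a strategy returns when run on a codeword. -/
def ProbeTree.run : ProbeTree → Codeword → Bool
  | .output b, _ => b
  | .probe i t₀ t₁, w => if w.bit i = true then t₁.run w else t₀.run w

/-- `(r, d, n)`-locally decodable codes with adaptive probes: from the query index `j` and the
length of the codeword one gets a strategy that makes at most `d` probes and returns the bit
`x j`. (Such a map is automatically injective.) -/
def IsAdaptiveCode (d : ℕ) {n r : ℕ} (c : SparseVec n r → Codeword) : Prop :=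
  ∃ T : Fin n → ℕ → ProbeTree, (∀ j k, (T j k).depth ≤ d) ∧
    ∀ (x : SparseVec n r) (j : Fin n), (T j (c x).len).run (c x) = x.1 j

/-- `(r, d, n)`-locally decodable codes with non-adaptive probes: the query index `j` and the
length of the codeword determine a set `S` of at most `d` positions, and the bit `x j` is a
function `g` of `j`, of the length, and of the bits at the positions in `S`. -/
def IsNonadaptiveCode (d : ℕ) {n r : ℕ} (c : SparseVec n r → Codeword) : Prop :=
  ∃ (S : Fin n → ℕ → Finset ℕ) (g : (j : Fin n) → (k : ℕ) → (S j k → Bool) → Bool),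
    (∀ j k, (S j k).card ≤ d) ∧
    ∀ (x : SparseVec n r) (j : Fin n),
      g j (c x).len (fun i => (c x).bit i.1) = x.1 j

/-- The expected codeword length `𝔼[ℓ(c(Xⁿ))]` for `Xⁿ` uniform on the `r`-sparse sequences. -/
noncomputable def expectedLength {n r : ℕ} (c : SparseVec n r → Codeword) : ℝ :=
  (∑ x : SparseVec n r, ((c x).len : ℝ)) / (Fintype.card (SparseVec n r) : ℝ)

/-- `c` has the least expected length among the codes of the class `P`. -/
def IsOptimal {n r : ℕ} (P : (SparseVec n r → Codeword) → Prop) (c : SparseVec n r → Codeword) :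
    Prop :=
  P c ∧ ∀ c' : SparseVec n r → Codeword, P c' → expectedLength c ≤ expectedLength c'

end LocDec

namespace LocDec

/-! Write `N` for the number of sources, `m = r * d` and `E` for the expected length. Non-adaptive
codes are adaptive, so it suffices to bound `E` below for adaptive codes and to construct good
non-adaptive ones.

Lower bound: among codewords of one length `k`, a source is determined by the positions and contents
read by the queries for its ones, a set of at most `m` of `2 * k` pairs (`eq_of_certificate_eq`). By
Markov at least half of the sources have length at most `L = ⌊2 * E⌋₊`, so `N ≤ 2 * (L + 1) * (2 * L
+ m).choose m`. As `log N = Ω(m)` forces `L = Ω(m)`, the binomial is at most `(O(L / m)) ^ m`. The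
number `L + 1` of lengths supplies one more factor, whence the root of order `m + 1`
(`IsAdaptiveCode.le_expectedLength`).

Upper bound: a Bloom filter with `d` blocks of `B` cells, in which a random mark also makes each
index active with probability `1 / Q`. A random hash function serves a given source with probability
at least `1 / (2 * Q ^ r)` (`card_hash_le`). In a greedily chosen sequence of hash functions the
mean waiting time is at most `2 * Q ^ r` (`exists_schedule`), and the codeword's length reveals the
waiting time without any probe. Balancing `d * B` against `Q ^ r` gives the stated order. -/

/-! ### Non-adaptive codes are adaptive. -/

/-- The tree probes the points of `S` one by one; after reading `b` at `a`, it remains to compute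
`G` with coordinate `a` frozen at `b`. -/
theorem exists_probeTree_of_dependsOn (S : Finset ℕ) (G : (ℕ → Bool) → Bool)
    (hG : ∀ u v : ℕ → Bool, (∀ i ∈ S, u i = v i) → G u = G v) :
    ∃ T : ProbeTree, T.depth ≤ S.card ∧ ∀ w : Codeword, T.run w = G w.bit := by
  induction S using Finset.induction_on generalizing G with
  | empty =>
    exact ⟨.output (G fun _ => false), by simp [ProbeTree.depth],
      fun w => hG _ _ (by simp)⟩
  | insert a S ha ih =>
    have key : ∀ b : Bool, ∃ T : ProbeTree, T.depth ≤ S.card ∧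
        ∀ w : Codeword, T.run w = G (Function.update w.bit a b) := by
      intro b
      refine ih (fun u => G (Function.update u a b)) fun u v huv => hG _ _ fun i hi => ?_
      by_cases h : i = a
      · simp [h]
      · simpa [h] using huv i ((Finset.mem_insert.1 hi).resolve_left h)
    obtain ⟨T₀, h₀, h₀'⟩ := key false
    obtain ⟨T₁, h₁, h₁'⟩ := key true
    refine ⟨.probe a T₀ T₁, ?_, fun w => ?_⟩
    · rw [Finset.card_insert_of_notMem ha]
      simp [ProbeTree.depth, h₀, h₁]
    · have hw : ∀ b, w.bit a = b → G (Function.update w.bit a b) = G w.bit := by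
        rintro b rfl
        rw [Function.update_eq_self]
      rw [ProbeTree.run]
      split_ifs with hb
      · rw [h₁', hw true hb]
      · rw [h₀', hw false (by simpa using hb)]

theorem IsNonadaptiveCode.isAdaptiveCode {d n r : ℕ} {c : SparseVec n r → Codeword}
    (hc : IsNonadaptiveCode d c) : IsAdaptiveCode d c := by
  obtain ⟨S, g, hS, hg⟩ := hc
  have key : ∀ j k, ∃ T : ProbeTree, T.depth ≤ (S j k).card ∧
      ∀ w : Codeword, T.run w = g j k (fun i => w.bit i.1) := fun j k =>
    exists_probeTree_of_dependsOn (S j k) (fun u => g j k fun i => u i.1)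
      fun u v huv => congrArg _ (funext fun i => huv i.1 i.2)
  choose T hT hT' using key
  exact ⟨T, fun j k => (hT j k).trans (hS j k), fun x j => (hT' _ _ _).trans (hg x j)⟩

/-! ### Lower bound: certificates and counting. -/

/-- The set of positions that a strategy probes when run on a codeword. -/
def ProbeTree.probed : ProbeTree → Codeword → Finset ℕ
  | .output _, _ => ∅
  | .probe i t₀ t₁, w => insert i (if w.bit i = true then t₁.probed w else t₀.probed w)

theorem ProbeTree.card_probed_le (T : ProbeTree) (w : Codeword) :
    (T.probed w).card ≤ T.depth := by
  induction T with
  | output b => simp [probed, depth]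
  | probe i t₀ t₁ h₀ h₁ =>
    refine (Finset.card_insert_le _ _).trans ?_
    simp only [depth]
    split_ifs <;> omega

theorem ProbeTree.run_congr (T : ProbeTree) {w w' : Codeword}
    (h : ∀ i ∈ T.probed w, w'.bit i = w.bit i) : T.run w' = T.run w := by
  induction T with
  | output b => rfl
  | probe i t₀ t₁ h₀ h₁ =>
    have hi := h i (Finset.mem_insert_self _ _)
    simp only [run, hi]
    split_ifs with hb
    · exact h₁ fun a ha => h a (Finset.mem_insert_of_mem (by simpa [hb] using ha))
    · exact h₀ fun a ha => h a (Finset.mem_insert_of_mem (by simpa [hb] using ha))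

theorem Codeword.bit_of_len_le {w : Codeword} {i : ℕ} (h : w.len ≤ i) : w.bit i = false :=
  List.getD_eq_default _ _ h

/-- The ones of a sparse sequence. -/
def SparseVec.supp {n r : ℕ} (x : SparseVec n r) : Finset (Fin n) :=
  Finset.univ.filter fun i => x.1 i = true

theorem SparseVec.mem_supp {n r : ℕ} {x : SparseVec n r} {j : Fin n} :
    j ∈ x.supp ↔ x.1 j = true := by simp [supp]

theorem SparseVec.card_supp {n r : ℕ} (x : SparseVec n r) : x.supp.card = r := x.2

theorem SparseVec.eq_of_supp_subset {n r : ℕ} {x y : SparseVec n r} (h : x.supp ⊆ y.supp) :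
    x = y := by
  have h' := Finset.eq_of_subset_of_card_le h (by rw [x.card_supp, y.card_supp])
  refine Subtype.ext (funext fun j => Bool.eq_iff_iff.2 ?_)
  rw [← mem_supp, ← mem_supp, h']

/-- The positions within the codeword, with their contents, that are probed by the queries for
the ones of `x`. -/
def certificate {n r : ℕ} (T : Fin n → ProbeTree) (w : Codeword) (x : SparseVec n r) :
    Finset (ℕ × Bool) :=
  x.supp.biUnion fun j =>
    (((T j).probed w).filter fun i => i < w.len).image fun i => (i, w.bit i)

theorem card_certificate_le {n r d : ℕ} {T : Fin n → ProbeTree} (hT : ∀ j, (T j).depth ≤ d)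
    (w : Codeword) (x : SparseVec n r) : (certificate T w x).card ≤ r * d := by
  refine (Finset.card_biUnion_le_card_mul x.supp _ d fun j _ => ?_).trans_eq (by rw [x.card_supp])
  exact Finset.card_image_le.trans ((Finset.card_filter_le _ _).trans
    (((T j).card_probed_le w).trans (hT j)))

theorem certificate_subset {n r : ℕ} (T : Fin n → ProbeTree)
    (w : Codeword) (x : SparseVec n r) :
    certificate T w x ⊆ Finset.range w.len ×ˢ Finset.univ := by
  intro p hp
  simp only [certificate, Finset.mem_biUnion, Finset.mem_image, Finset.mem_filter] at hp
  obtain ⟨j, _, i, ⟨_, hi⟩, rfl⟩ := hp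
  simpa using hi

/-- For a one `j` of `x`, equal certificates make `w'` agree with `w` wherever the query for `j`
looks, so `j` is a one of `x'` too. Both supports have `r` elements, so inclusion is equality. -/
theorem eq_of_certificate_eq {n r : ℕ} {T : Fin n → ProbeTree} {w w' : Codeword}
    {x x' : SparseVec n r} (hlen : w.len = w'.len)
    (hw : ∀ j, (T j).run w = x.1 j) (hw' : ∀ j, (T j).run w' = x'.1 j)
    (h : certificate T w x = certificate T w' x') : x = x' := by
  refine SparseVec.eq_of_supp_subset fun j hj => ?_
  rw [SparseVec.mem_supp, ← hw', (T j).run_congr (w := w), hw, ← SparseVec.mem_supp]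
  · exact hj
  intro i hi
  by_cases hil : i < w.len
  · have hmem : (i, w.bit i) ∈ certificate T w x := by
      simp only [certificate, Finset.mem_biUnion, Finset.mem_image, Finset.mem_filter]
      exact ⟨j, hj, i, ⟨hi, hil⟩, rfl⟩
    rw [h] at hmem
    simp only [certificate, Finset.mem_biUnion, Finset.mem_image, Finset.mem_filter,
      Prod.mk.injEq] at hmem
    obtain ⟨_, _, i', _, rfl, hb⟩ := hmem
    exact hb
  -- Probes past the end are absent from the certificate, but both words read `false` there.
  · rw [Codeword.bit_of_len_le (not_lt.1 hil), Codeword.bit_of_len_le (hlen ▸ not_lt.1 hil)]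

/-- By Vandermonde the right side is the sum of `s.card.choose i * m.choose (m - i)` over `i ≤ m`,
and every second factor is at least 1. -/
theorem card_filter_card_le_choose {α : Type*} (s : Finset α) (m : ℕ) :
    (s.powerset.filter fun t => t.card ≤ m).card ≤ (s.card + m).choose m := by
  classical
  rw [Finset.card_eq_sum_card_fiberwise (f := Finset.card) (t := Finset.range (m + 1))
    (by intro t ht; simp at ht ⊢; omega), Nat.add_choose_eq,
    Finset.Nat.sum_antidiagonal_eq_sum_range_succ_mk]
  refine Finset.sum_le_sum fun i hi => ?_
  have hi' : i ≤ m := by simpa [Nat.lt_succ_iff] using hi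
  refine le_trans ?_ (Nat.le_mul_of_pos_right _ (Nat.choose_pos (Nat.sub_le m i)))
  rw [← Finset.card_powersetCard]
  refine Finset.card_le_card fun t ht => ?_
  simp only [Finset.mem_filter, Finset.mem_powerset, Finset.mem_powersetCard] at ht ⊢
  exact ⟨ht.1.1, ht.2⟩

/-- Certificates are subsets of a set of `2 * k` pairs. The crude bound `4 ^ k` serves to show that
`r * d` is at most a multiple of the length; the second bound is the sharp one. -/
theorem IsAdaptiveCode.card_len_eq_le {d n r : ℕ} {c : SparseVec n r → Codeword}
    (hc : IsAdaptiveCode d c) (k : ℕ) :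
    (Finset.univ.filter fun x => (c x).len = k).card ≤ 4 ^ k ∧
    (Finset.univ.filter fun x => (c x).len = k).card ≤ (2 * k + r * d).choose (r * d) := by
  obtain ⟨T, hT, hT'⟩ := hc
  set s : Finset (ℕ × Bool) := Finset.range k ×ˢ Finset.univ with hs
  have hcard : s.card = 2 * k := by simp [hs, mul_comm]
  have h : (Finset.univ.filter fun x => (c x).len = k).card ≤
      (s.powerset.filter fun t => t.card ≤ r * d).card := by
    refine Finset.card_le_card_of_injOn (fun x => certificate (fun j => T j k) (c x) x) ?_ ?_
    · intro x hx
      have hx : (c x).len = k := by simpa using hx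
      simp only [Finset.coe_filter, Finset.mem_powerset, Set.mem_ofPred_eq]
      refine ⟨?_, card_certificate_le (fun j => hT j k) _ _⟩
      rw [hs, ← hx]
      exact certificate_subset _ _ _
    · intro x hx y hy hxy
      have hx : (c x).len = k := by simpa using hx
      have hy : (c y).len = k := by simpa using hy
      refine eq_of_certificate_eq (hx.trans hy.symm) (fun j => ?_) (fun j => ?_) hxy
      · rw [← hT' x j, hx]
      · rw [← hT' y j, hy]
  constructor
  · refine h.trans ((Finset.card_filter_le _ _).trans ?_)
    rw [Finset.card_powerset, hcard, pow_mul]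
    norm_num
  · have := h.trans (card_filter_card_le_choose s (r * d))
    rwa [hcard] at this

/-! ### Lower bound: from counts by length to expected length. -/

theorem card_sparseVec (n r : ℕ) : Fintype.card (SparseVec n r) = n.choose r := by
  classical
  have h : ((Finset.univ : Finset (Fin n)).powersetCard r).card = n.choose r := by simp
  rw [← h, ← Fintype.card_coe]
  refine Fintype.card_congr
    { toFun := fun x => ⟨x.supp, by simp [Finset.mem_powersetCard, x.card_supp]⟩
      invFun := fun s => ⟨fun i => decide (i ∈ s.1), by
        have := (Finset.mem_powersetCard.1 s.2).2
        simpa using this⟩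
      left_inv := fun x => by ext i; simp [SparseVec.supp]
      right_inv := fun s => by ext i; simp [SparseVec.supp] }

theorem one_le_expectedLength {n r : ℕ} (h : r ≤ n) (c : SparseVec n r → Codeword) :
    1 ≤ expectedLength c := by
  have hN : (0 : ℝ) < Fintype.card (SparseVec n r) := by
    rw [card_sparseVec]; exact_mod_cast Nat.choose_pos h
  rw [expectedLength, le_div_iff₀ hN, one_mul]
  calc (Fintype.card (SparseVec n r) : ℝ) = ∑ _x : SparseVec n r, (1 : ℝ) := by simp
    _ ≤ _ := Finset.sum_le_sum fun x _ => by
      exact_mod_cast List.length_pos_iff.2 (c x).2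

/-- At least half of the sequences have codewords of at most twice the expected length. -/
theorem choose_le_two_mul_card_short {n r : ℕ} (h : r ≤ n) (c : SparseVec n r → Codeword) :
    n.choose r ≤
      2 * (Finset.univ.filter fun x => (c x).len ≤ ⌊2 * expectedLength c⌋₊).card := by
  have hN : (0 : ℝ) < Fintype.card (SparseVec n r) := by
    rw [card_sparseVec]; exact_mod_cast Nat.choose_pos h
  have hE := one_le_expectedLength h c
  set E := expectedLength c with hEdef
  have hsum : ∑ x : SparseVec n r, ((c x).len : ℝ) = E * Fintype.card (SparseVec n r) := by
    rw [hEdef, expectedLength, div_mul_cancel₀ _ hN.ne']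
  set A := Finset.univ.filter fun x : SparseVec n r => (c x).len ≤ ⌊2 * E⌋₊
  set A' := Finset.univ.filter fun x : SparseVec n r => ¬ (c x).len ≤ ⌊2 * E⌋₊
  have hAA : A.card + A'.card = n.choose r := by
    rw [← card_sparseVec, ← Finset.card_univ]
    exact Finset.card_filter_add_card_filter_not _
  -- Markov's inequality for the sources with length above `2 * E`.
  have h1 : (A'.card : ℝ) * (2 * E) ≤ E * n.choose r := by
    rw [← card_sparseVec, ← hsum, ← nsmul_eq_mul]
    refine (Finset.card_nsmul_le_sum A' _ _ fun x hx => ?_).trans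
      (Finset.sum_le_sum_of_subset_of_nonneg (Finset.subset_univ _) fun _ _ _ => by positivity)
    have : ⌊2 * E⌋₊ < (c x).len := by simpa [A'] using hx
    exact (Nat.lt_of_floor_lt this).le
  have h2 : (2 * A'.card : ℝ) ≤ n.choose r := by nlinarith
  have h3 : 2 * A'.card ≤ n.choose r := by exact_mod_cast h2
  omega

theorem IsAdaptiveCode.choose_le {d n r : ℕ} (h : r ≤ n) {c : SparseVec n r → Codeword}
    (hc : IsAdaptiveCode d c) {L : ℕ} (hL : L = ⌊2 * expectedLength c⌋₊) :
    n.choose r ≤ 2 * ((L + 1) * 4 ^ L) ∧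
    n.choose r ≤ 2 * ((L + 1) * (2 * L + r * d).choose (r * d)) := by
  have key : ∀ M : ℕ, (∀ k ≤ L, (Finset.univ.filter fun x => (c x).len = k).card ≤ M) →
      n.choose r ≤ 2 * ((L + 1) * M) := by
    intro M hM
    refine (choose_le_two_mul_card_short h c).trans (Nat.mul_le_mul_left 2 ?_)
    rw [← hL, Finset.card_eq_sum_card_fiberwise (f := fun x => (c x).len)
      (t := Finset.range (L + 1)) (by intro t ht; simp at ht ⊢; omega)]
    refine (Finset.sum_le_card_nsmul _ _ M fun k hk => ?_).trans (by simp)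
    refine le_trans (Finset.card_le_card ?_) (hM k (by simpa [Nat.lt_succ_iff] using hk))
    intro x hx
    simp at hx ⊢
    exact hx.2
  refine ⟨key _ fun k hk => ?_, key _ fun k hk => ?_⟩
  · exact (hc.card_len_eq_le k).1.trans (Nat.pow_le_pow_right (by norm_num) hk)
  · exact (hc.card_len_eq_le k).2.trans (Nat.choose_le_choose _ (by omega))

/-- The lower bound on the length of codes, with explicit constants. -/
theorem IsAdaptiveCode.le_expectedLength {d n r : ℕ} (hr : 1 ≤ r) (hrn : r ≤ n) (hd : 1 ≤ d)
    {A : ℝ} (hA : 0 < A) (hlog : (r : ℝ) * d ≤ A * Real.logb 2 (n.choose r))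
    {c : SparseVec n r → Codeword} (hc : IsAdaptiveCode d c) :
    (r : ℝ) * d * (n.choose r : ℝ) ^ (1 / ((r : ℝ) * d + 1)) ≤
      8 * (Real.exp 1 * (2 + 4 * A)) * expectedLength c := by
  obtain ⟨L, hL⟩ : ∃ L, L = ⌊2 * expectedLength c⌋₊ := ⟨_, rfl⟩
  have hE := one_le_expectedLength hrn c
  have hLE : (L : ℝ) ≤ 2 * expectedLength c := by
    rw [hL]; exact Nat.floor_le (by linarith)
  have hL1 : 1 ≤ L := by
    rw [hL]; exact Nat.le_floor (by push_cast; linarith)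
  obtain ⟨h4, hch⟩ := hc.choose_le hrn hL
  obtain ⟨m, hm⟩ : ∃ m, m = r * d := ⟨_, rfl⟩
  have hm1 : 1 ≤ m := hm ▸ Nat.mul_pos hr hd
  have hmR : (r : ℝ) * d = m := by rw [hm]; push_cast; ring
  rw [hmR] at hlog ⊢
  rw [← hm] at hch
  have hm0 : (0 : ℝ) < m := by exact_mod_cast hm1
  have hL0 : (0 : ℝ) < L := by exact_mod_cast hL1
  have hN0 : (0 : ℝ) < n.choose r := by exact_mod_cast Nat.choose_pos hrn
  -- The hypothesis `m = O(log N)` enters here, through `N ≤ 2 * (L + 1) * 4 ^ L ≤ 16 ^ L`.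
  have hmL : (m : ℝ) ≤ 4 * A * L := by
    have h16 : n.choose r ≤ 16 ^ L := by
      have h1 : L + 1 ≤ 2 ^ L := Nat.lt_two_pow_self
      have h2 : 2 ≤ 2 ^ L := (by omega : 2 ≤ L + 1).trans h1
      calc n.choose r ≤ 2 * ((L + 1) * 4 ^ L) := h4
        _ ≤ 2 ^ L * (2 ^ L * 4 ^ L) := by gcongr
        _ = 16 ^ L := by rw [← mul_pow, ← mul_pow]; norm_num
    have : Real.logb 2 (n.choose r) ≤ 4 * L := by
      rw [Real.logb_le_iff_le_rpow (by norm_num) hN0]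
      calc (n.choose r : ℝ) ≤ 16 ^ L := by exact_mod_cast h16
        _ = (2 : ℝ) ^ ((4 * L : ℕ) : ℝ) := by rw [Real.rpow_natCast, pow_mul]; norm_num
        _ = _ := by push_cast; rfl
    nlinarith
  set D := Real.exp 1 * (2 + 4 * A) with hD
  have hexp : 1 ≤ Real.exp 1 := Real.one_le_exp (by norm_num)
  have hD1 : 1 ≤ D := by nlinarith
  have hchoose : ((2 * L + m).choose m : ℝ) ≤ (D * L / m) ^ m := by
    have h1 : ((2 * L + m).choose m : ℝ) ≤ ((2 * L + m : ℕ) : ℝ) ^ m / m.factorial :=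
      Nat.choose_le_pow_div _ _
    have h2 : (m : ℝ) ^ m / m.factorial ≤ Real.exp m := Real.pow_div_factorial_le_exp _ hm0.le _
    have h3 : ((2 * L + m : ℕ) : ℝ) ≤ (2 + 4 * A) * L := by push_cast; linarith
    calc ((2 * L + m).choose m : ℝ) ≤ ((2 + 4 * A) * L) ^ m / m.factorial := by
          refine h1.trans ?_; gcongr
      _ = ((2 + 4 * A) * L / m) ^ m * (m ^ m / m.factorial) := by
          rw [div_pow]; field_simp
      _ ≤ ((2 + 4 * A) * L / m) ^ m * Real.exp m := by gcongr
      _ = (D * L / m) ^ m := by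
          rw [← Real.exp_one_pow, ← mul_pow, hD]; congr 1; ring
  -- The prefactor `2 * (L + 1) ≤ 4 * m * (L / m)` becomes the factor of index `m + 1`, since `4 * m
  -- ≤ 4 ^ (m + 1)` and `1 ≤ D`.
  have hNle : (n.choose r : ℝ) ≤ (4 * D * L / m) ^ (m + 1) := by
    have h5 : (4 * m : ℝ) ≤ 4 ^ (m + 1) := by
      have : m < 4 ^ m := Nat.lt_pow_self (by norm_num)
      rw [pow_succ]
      have : (m : ℝ) ≤ 4 ^ m := by exact_mod_cast this.le
      linarith
    calc (n.choose r : ℝ) ≤ 2 * ((L + 1) * (2 * L + m).choose m) := by exact_mod_cast hch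
      _ ≤ 2 * ((L + L) * (D * L / m) ^ m) := by
          have : (1 : ℝ) ≤ L := by exact_mod_cast hL1
          gcongr
      _ = 4 * m * ((1 * L / m) * (D * L / m) ^ m) := by field_simp; ring
      _ ≤ 4 ^ (m + 1) * ((D * L / m) * (D * L / m) ^ m) := by gcongr
      _ = (4 * D * L / m) ^ (m + 1) := by
          rw [← pow_succ', ← mul_pow]; congr 1; ring
  have hroot : (n.choose r : ℝ) ^ (1 / ((m : ℝ) + 1)) ≤ 4 * D * L / m := by
    rw [one_div]
    refine (Real.rpow_inv_le_iff_of_pos hN0.le (by positivity) (by positivity)).2 ?_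
    exact_mod_cast hNle
  calc (m : ℝ) * (n.choose r : ℝ) ^ (1 / ((m : ℝ) + 1)) ≤ m * (4 * D * L / m) := by gcongr
    _ = 4 * D * L := by field_simp
    _ ≤ 4 * D * (2 * expectedLength c) := by gcongr
    _ = _ := by ring

/-! ### Upper bound: greedy scheduling. -/

/-- Greedy scheduling: if every point is good for at least a fraction `1 / M` of all `h`, then one
can pick a sequence of `h`s such that the points of `R` wait at most `M` steps on average until
they are served. -/
theorem exists_schedule {α H : Type*} [Fintype H] [Nonempty H]
    (good : H → α → Prop) (M : ℕ)
    (hM : ∀ x, Fintype.card H ≤ M * {h | good h x}.ncard) (R : Finset α) :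
    ∃ (t : α → ℕ) (h : ℕ → H), (∀ x ∈ R, good (h (t x)) x) ∧
      ∑ x ∈ R, t x ≤ M * R.card := by
  classical
  induction R using Finset.strongInduction with
  | H R ih =>
    obtain rfl | hR := R.eq_empty_or_nonempty
    · exact ⟨fun _ => 0, fun _ => Classical.arbitrary H, by simp, by simp⟩
    -- Double counting of the pairs with `good h x`: some `h` serves at least the average share of
    -- `R`.
    have havg : ∃ h, R.card ≤ M * (R.filter (good h)).card := by
      by_contra! hlt
      have h1 : ∑ h : H, M * (R.filter (good h)).card < ∑ _h : H, R.card :=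
        Finset.sum_lt_sum_of_nonempty Finset.univ_nonempty fun h _ => hlt h
      have h2 : ∑ h : H, M * (R.filter (good h)).card =
          ∑ x ∈ R, M * {h | good h x}.ncard := by
        simp only [← Finset.mul_sum, Finset.card_filter]
        rw [Finset.sum_comm]
        congr 1
        refine Finset.sum_congr rfl fun x _ => ?_
        rw [← Finset.card_filter, ← Set.ncard_coe_finset]
        congr 1
        ext h
        simp
      rw [h2] at h1
      have h3 : ∑ x ∈ R, Fintype.card H ≤ ∑ x ∈ R, M * {h | good h x}.ncard :=
        Finset.sum_le_sum fun x _ => hM x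
      simp only [Finset.sum_const, smul_eq_mul, Finset.card_univ] at h1 h3
      rw [mul_comm] at h3
      omega
    obtain ⟨h₀, hh₀⟩ := havg
    set G := R.filter (good h₀) with hG
    set R' := R.filter fun x => ¬ good h₀ x with hR'
    have hcard : G.card + R'.card = R.card := Finset.card_filter_add_card_filter_not _
    have hlt : R' ⊂ R := by
      refine Finset.ssubset_iff_subset_ne.2 ⟨Finset.filter_subset _ _, fun heq => ?_⟩
      rw [heq] at hcard
      have : G.card = 0 := by omega
      rw [this] at hh₀
      have := hR.card_pos
      omega
    obtain ⟨t, h, hgood, hsum⟩ := ih R' hlt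
    refine ⟨fun x => if good h₀ x then 0 else t x + 1, fun k => k.casesOn h₀ h,
      fun x hx => ?_, ?_⟩
    · by_cases hx' : good h₀ x
      · simp [hx']
      · simpa [hx'] using hgood x (by simp [hR', hx, hx'])
    · have h1 : ∑ x ∈ R, (if good h₀ x then 0 else t x + 1) = ∑ x ∈ R', (t x + 1) := by
        rw [hR', Finset.sum_filter]
        exact Finset.sum_congr rfl fun x _ => by split_ifs <;> simp_all
      rw [h1, Finset.sum_add_distrib, Finset.sum_const, smul_eq_mul, mul_one]
      -- Each unserved point waits one extra step; this costs `R'.card ≤ R.card ≤ M * G.card`.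
      calc _ ≤ M * R'.card + M * G.card := by
            have := Finset.card_le_card hlt.subset
            omega
        _ = _ := by rw [← mul_add, add_comm, hcard]

/-! ### Upper bound: Bloom filters with activation marks. -/

/-- The values of a hash function: an activation mark, active if it is `0`, and a cell in each
of `d` blocks. -/
abbrev HashValue (Q d B : ℕ) : Type := Fin Q × (Fin d → Fin B)

section Hash

variable {n r Q d B : ℕ}

/-- The codeword of length `d * B + t` marking the cells occupied by the ones of `x`. -/
noncomputable def hashWord (h : Fin n → HashValue Q d B) (x : SparseVec n r) (t : ℕ) : List Bool :=
  open Classical in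
  List.ofFn fun p : Fin (d * B + t) => decide (∃ i, ∃ j ∈ x.supp,
    (finProdFinEquiv (i, (h j).2 i) : Fin (d * B)).1 = p.1)

theorem hashWord_getD (h : Fin n → HashValue Q d B) (x : SparseVec n r) (t : ℕ)
    (i : Fin d) (b : Fin B) :
    (hashWord h x t).getD (finProdFinEquiv (i, b)).1 false = true ↔
      ∃ j ∈ x.supp, (h j).2 i = b := by
  have hlt : (finProdFinEquiv (i, b)).1 < d * B + t := by
    have := (finProdFinEquiv (i, b)).2; omega
  rw [List.getD_eq_getElem _ _ (by simpa [hashWord] using hlt)]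
  simp only [hashWord, List.getElem_ofFn, decide_eq_true_eq]
  constructor
  · rintro ⟨i', j, hj, he⟩
    have := finProdFinEquiv.injective (Fin.ext he)
    simp only [Prod.mk.injEq] at this
    obtain ⟨rfl, hb⟩ := this
    exact ⟨j, hj, hb⟩
  · rintro ⟨j, hj, rfl⟩
    exact ⟨i, j, hj, rfl⟩


variable [NeZero Q]

/-- All ones of `x` are active. -/
def OnesActive (h : Fin n → HashValue Q d B) (x : SparseVec n r) : Prop :=
  ∀ j ∈ x.supp, (h j).1 = 0

/-- The index `j` is active and all its cells are occupied by ones of `x`. -/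
def Covered (h : Fin n → HashValue Q d B) (x : SparseVec n r) (j : Fin n) : Prop :=
  (h j).1 = 0 ∧ ∀ i, ∃ j' ∈ x.supp, (h j').2 i = (h j).2 i

/-- The hash function `h` represents `x` faithfully. -/
def Represents (h : Fin n → HashValue Q d B) (x : SparseVec n r) : Prop :=
  OnesActive h x ∧ ∀ j ∉ x.supp, ¬ Covered h x j

open Classical in
theorem card_onesActive (x : SparseVec n r) :
    Q ^ r * (Finset.univ.filter fun h : Fin n → HashValue Q d B => OnesActive h x).card =
      (Q * B ^ d) ^ n := by
  have h1 : (Finset.univ.filter fun h : Fin n → HashValue Q d B => OnesActive h x) =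
      Fintype.piFinset fun j => if j ∈ x.supp then ({0} : Finset (Fin Q)) ×ˢ Finset.univ
        else Finset.univ := by
    ext h
    rw [Finset.mem_filter, Fintype.mem_piFinset]
    simp only [Finset.mem_univ, true_and, OnesActive]
    refine forall_congr' fun j => ?_
    by_cases hj : j ∈ x.supp
    · simp only [hj, if_true, Finset.mem_product, Finset.mem_singleton, Finset.mem_univ,
        and_true, forall_const]
    · simp [hj]
  have h2 : Q ^ r = ∏ j : Fin n, if j ∈ x.supp then Q else 1 := by
    rw [Finset.prod_ite_mem, Finset.univ_inter, Finset.prod_const, x.card_supp]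
  rw [h1, Fintype.card_piFinset, h2, ← Finset.prod_mul_distrib, Finset.prod_congr rfl
    (g := fun _ => Q * B ^ d)]
  · simp
  · intro j _
    by_cases hj : j ∈ x.supp <;> simp [hj]

-- Conditionally on the values at the ones of `x`, the value at `j` is uniform, and at most `r ^ d`
-- of its `Q * B ^ d` values make `j` covered. The counting form resamples: `(h, v)` goes to `h`
-- with value `v` at `j`, paired with the old value `h j`. The set `F` of bad values depends only on
-- the values at the ones, so it survives the resampling.
open Classical in
theorem card_covered_le (x : SparseVec n r) {j : Fin n} (hj : j ∉ x.supp) :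
    (Finset.univ.filter fun h : Fin n → HashValue Q d B =>
        OnesActive h x ∧ Covered h x j).card * (Q * B ^ d) ≤
      (Finset.univ.filter fun h : Fin n → HashValue Q d B => OnesActive h x).card * r ^ d := by
  set F : (Fin n → HashValue Q d B) → Finset (HashValue Q d B) := fun h =>
    {0} ×ˢ Fintype.piFinset fun i => x.supp.image fun j' => (h j').2 i
  have hF : ∀ h, (F h).card ≤ r ^ d := fun h => by
    rw [Finset.card_product, Finset.card_singleton, one_mul, Fintype.card_piFinset]
    refine (Finset.prod_le_pow_card _ _ r fun i _ => ?_).trans (by simp)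
    exact Finset.card_image_le.trans x.card_supp.le
  have hne : ∀ j' ∈ x.supp, j' ≠ j := fun j' hj' h => hj (h ▸ hj')
  calc _ = ((Finset.univ.filter fun h : Fin n → HashValue Q d B =>
        OnesActive h x ∧ Covered h x j) ×ˢ
          (Finset.univ : Finset (HashValue Q d B))).card := by
        rw [Finset.card_product]; simp
    _ ≤ ((Finset.univ.filter fun h : Fin n → HashValue Q d B => OnesActive h x).sigma F).card := by
        refine Finset.card_le_card_of_injOn
          (fun p => ⟨Function.update p.1 j p.2, p.1 j⟩) ?_ ?_
        · rintro ⟨h, v⟩ hp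
          simp only [Finset.coe_product, Finset.coe_filter, Finset.mem_univ, true_and,
            Finset.coe_univ, Set.mem_prod, Set.mem_ofPred_eq, Set.mem_univ, and_true] at hp
          obtain ⟨h1, h2, h3⟩ := hp
          simp only [Finset.coe_sigma, Set.mem_sigma_iff, Finset.coe_filter, Finset.mem_univ,
            true_and, Set.mem_ofPred_eq, Finset.mem_coe]
          refine ⟨fun j' hj' => ?_, ?_⟩
          · rw [Function.update_of_ne (hne j' hj')]
            exact h1 j' hj'
          · simp only [F, Finset.mem_product, Finset.mem_singleton, Fintype.mem_piFinset,
              Finset.mem_image]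
            refine ⟨h2, fun i => ?_⟩
            obtain ⟨j', hj', he⟩ := h3 i
            exact ⟨j', hj', by rw [Function.update_of_ne (hne j' hj'), he]⟩
        · rintro ⟨h, v⟩ _ ⟨h', v'⟩ _ heq
          simp only [Sigma.mk.injEq, heq_eq_eq] at heq
          obtain ⟨h1, h2⟩ := heq
          have hv : v = v' := by simpa using congrFun h1 j
          refine Prod.ext (funext fun a => ?_) hv
          by_cases ha : a = j
          · rw [ha]; exact h2
          · simpa [ha] using congrFun h1 a
    _ ≤ _ := by
        rw [Finset.card_sigma]
        exact (Finset.sum_le_card_nsmul _ _ _ fun h _ => hF h).trans (by simp)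

/-- The union bound: a uniformly random hash function represents `x` with probability at least
`1 / (2 Q ^ r)`. -/
theorem card_hash_le (hB : 2 * (n * r ^ d) ≤ Q * B ^ d) (hB0 : 0 < B) (x : SparseVec n r) :
    Fintype.card (Fin n → HashValue Q d B) ≤
      2 * Q ^ r * {h : Fin n → HashValue Q d B | Represents h x}.ncard := by
  classical
  set H₁ := Finset.univ.filter fun h : Fin n → HashValue Q d B => OnesActive h x with hH₁
  set W := fun j => Finset.univ.filter fun h : Fin n → HashValue Q d B =>
        OnesActive h x ∧ Covered h x j with hW
  set G := Finset.univ.filter fun h : Fin n → HashValue Q d B => Represents h x with hG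
  have hncard : {h : Fin n → HashValue Q d B | Represents h x}.ncard = G.card := by
    rw [← Set.ncard_coe_finset]; congr 1; ext h; simp [hG]
  have hsub : H₁ ⊆ G ∪ (Finset.univ \ x.supp).biUnion W := by
    intro h hh
    have hh : OnesActive h x := by simpa [hH₁] using hh
    by_cases hr : Represents h x
    · exact Finset.mem_union_left _ (by simpa [hG] using hr)
    · refine Finset.mem_union_right _ ?_
      simp only [Represents, hh, true_and, not_forall, not_not] at hr
      obtain ⟨j, hj, hc⟩ := hr
      simp only [Finset.mem_biUnion, hW, Finset.mem_filter, Finset.mem_sdiff, Finset.mem_univ,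
        true_and]
      exact ⟨j, hj, hh, hc⟩
  have hle : H₁.card ≤ G.card + ∑ j ∈ Finset.univ \ x.supp, (W j).card :=
    (Finset.card_le_card hsub).trans ((Finset.card_union_le _ _).trans
      (Nat.add_le_add_left Finset.card_biUnion_le _))
  have hpos : 0 < Q * B ^ d := Nat.mul_pos (NeZero.pos Q) (Nat.pow_pos hB0)
  have hW' : (∑ j ∈ Finset.univ \ x.supp, (W j).card) * (Q * B ^ d) ≤ n * (H₁.card * r ^ d) := by
    rw [Finset.sum_mul]
    refine (Finset.sum_le_card_nsmul _ _ (H₁.card * r ^ d) fun j hj => ?_).trans ?_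
    · exact card_covered_le x (by simpa using hj)
    · rw [smul_eq_mul]
      refine Nat.mul_le_mul_right _ ((Finset.card_le_univ _).trans (by simp))
  -- `hB` says that `n` times the conditional probability `r ^ d / (Q * B ^ d)` is at most one half.
  have hhalf : 2 * (∑ j ∈ Finset.univ \ x.supp, (W j).card) ≤ H₁.card := by
    refine Nat.le_of_mul_le_mul_right ?_ hpos
    calc _ = 2 * ((∑ j ∈ Finset.univ \ x.supp, (W j).card) * (Q * B ^ d)) := by ring
      _ ≤ 2 * (n * (H₁.card * r ^ d)) := Nat.mul_le_mul_left _ hW'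
      _ = H₁.card * (2 * (n * r ^ d)) := by ring
      _ ≤ _ := Nat.mul_le_mul_left _ hB
  have h2 : H₁.card ≤ 2 * G.card := by omega
  have hH := card_onesActive (Q := Q) (d := d) (B := B) x
  rw [hncard]
  calc Fintype.card (Fin n → HashValue Q d B) = (Q * B ^ d) ^ n := by simp
    _ = Q ^ r * H₁.card := by rw [← hH]
    _ ≤ Q ^ r * (2 * G.card) := Nat.mul_le_mul_left _ h2
    _ = _ := by ring

/-- The hash construction of non-adaptive codes. -/
theorem exists_nonadaptiveCode (hrn : r ≤ n) (hB : 2 * (n * r ^ d) ≤ Q * B ^ d) (hB0 : 0 < B)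
    (hd : 1 ≤ d) :
    ∃ c : SparseVec n r → Codeword, IsNonadaptiveCode d c ∧
      expectedLength c ≤ d * B + 2 * Q ^ r := by
  classical
  have : NeZero B := ⟨hB0.ne'⟩
  obtain ⟨t, h, hgood, hsum⟩ := exists_schedule (fun h x => Represents h x) (2 * Q ^ r)
    (card_hash_le (n := n) (r := r) hB hB0) Finset.univ
  have hlen : ∀ x : SparseVec n r, (hashWord (h (t x)) x (t x)).length = d * B + t x := fun x => by
    simp [hashWord]
  have hK : 0 < d * B := Nat.mul_pos hd hB0
  -- From the length `k` the decoder recovers the time `k - d * B`, hence the hash function. It then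
  -- probes the `d` cells of `j` and answers 1 if `j` is active and all of them are marked.
  refine ⟨fun x => ⟨hashWord (h (t x)) x (t x), fun he => ?_⟩, ⟨fun j k =>
    Finset.univ.image fun i => (finProdFinEquiv (i, (h (k - d * B) j).2 i)).1,
    fun j k f => decide ((h (k - d * B) j).1 = 0 ∧ ∀ p, f p = true), fun j k => ?_,
    fun x j => ?_⟩, ?_⟩
  · have := hlen x
    rw [he, List.length_nil] at this
    omega
  · exact Finset.card_image_le.trans (by simp)
  · have hx := hgood x (Finset.mem_univ _)
    have hk : Codeword.len ⟨hashWord (h (t x)) x (t x), fun he => by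
        have := hlen x
        rw [he, List.length_nil] at this
        omega⟩ - d * B = t x := by simp [Codeword.len, hlen]
    have hcov : Covered (h (t x)) x j ↔ x.1 j = true := by
      constructor
      · intro hc
        by_contra hj
        exact hx.2 j (fun hm => hj (SparseVec.mem_supp.1 hm)) hc
      · intro hj
        have hj := SparseVec.mem_supp.2 hj
        exact ⟨hx.1 j hj, fun i => ⟨j, hj, rfl⟩⟩
    rw [Bool.eq_iff_iff, ← hcov, decide_eq_true_iff, Covered]
    simp only [hk]
    refine and_congr_right fun _ => ?_
    simp only [Subtype.forall, Finset.mem_image, Finset.mem_univ, true_and, forall_exists_index,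
      forall_apply_eq_imp_iff, hk]
    exact forall_congr' fun i => hashWord_getD _ _ _ _ _
  · have hN : (0 : ℝ) < Fintype.card (SparseVec n r) := by
      rw [card_sparseVec]; exact_mod_cast Nat.choose_pos hrn
    rw [expectedLength, div_le_iff₀ hN]
    simp only [Codeword.len, hlen]
    rw [← Nat.cast_sum, Finset.sum_add_distrib, Finset.sum_const, smul_eq_mul, Finset.card_univ]
    rw [Finset.card_univ] at hsum
    calc ((Fintype.card (SparseVec n r) * (d * B) + ∑ x : SparseVec n r, t x : ℕ) : ℝ)
        ≤ ((Fintype.card (SparseVec n r) * (d * B) +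
          2 * Q ^ r * Fintype.card (SparseVec n r) : ℕ) : ℝ) :=
            Nat.cast_le.2 (Nat.add_le_add_left hsum _)
      _ = _ := by push_cast; ring

end Hash

/-! ### Upper bound: choice of parameters. -/

theorem pow_le_pow_mul_choose {n r : ℕ} (h : r ≤ n) : n ^ r ≤ r ^ r * n.choose r := by
  induction r generalizing n with
  | zero => simp
  | succ r ih =>
    obtain ⟨n, rfl⟩ : ∃ k, n = k + 1 := ⟨n - 1, by omega⟩
    have hrn : r ≤ n := by omega
    have hr : 0 < r ^ r := by
      rcases r.eq_zero_or_pos with rfl | h0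
      · simp
      · exact Nat.pow_pos h0
    have hpow : (n + 1) ^ r ≤ (r + 1) ^ r * n.choose r := by
      refine Nat.le_of_mul_le_mul_right ?_ hr
      calc (n + 1) ^ r * r ^ r = ((n + 1) * r) ^ r := (mul_pow _ _ _).symm
        _ ≤ ((r + 1) * n) ^ r := Nat.pow_le_pow_left (by nlinarith) _
        _ = (r + 1) ^ r * n ^ r := mul_pow _ _ _
        _ ≤ (r + 1) ^ r * (r ^ r * n.choose r) := Nat.mul_le_mul_left _ (ih hrn)
        _ = _ := by ring
    calc (n + 1) ^ (r + 1) = (n + 1) * (n + 1) ^ r := pow_succ' _ _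
      _ ≤ (n + 1) * ((r + 1) ^ r * n.choose r) := Nat.mul_le_mul_left _ hpow
      _ = (r + 1) ^ r * ((n + 1) * n.choose r) := by ring
      _ = (r + 1) ^ r * ((n + 1).choose (r + 1) * (r + 1)) := by rw [Nat.add_one_mul_choose_eq]
      _ = _ := by ring

/-- The upper bound on the length of optimal codes, with explicit constants. -/
theorem exists_nonadaptiveCode_expectedLength_le {d n r : ℕ} (hr : 1 ≤ r) (hrn : r ≤ n)
    (hd : 1 ≤ d) {A : ℝ} (hdr : Real.logb 2 r ≤ A * d) :
    ∃ c : SparseVec n r → Codeword, IsNonadaptiveCode d c ∧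
      expectedLength c ≤ (4 * (2 : ℝ) ^ A + 3) *
        ((r : ℝ) * d * (n.choose r : ℝ) ^ (1 / ((r : ℝ) * d + 1))) := by
  have hr0 : (0 : ℝ) < r := by exact_mod_cast hr
  have hr1 : (1 : ℝ) ≤ r := by exact_mod_cast hr
  have hd1 : (1 : ℝ) ≤ d := by exact_mod_cast hd
  have hnr : (r : ℝ) ≤ n := by exact_mod_cast hrn
  have hN1 : (1 : ℝ) ≤ n.choose r := by exact_mod_cast Nat.choose_pos hrn
  set C : ℝ := 4 * (2 : ℝ) ^ A with hC
  have hC0 : 0 < C := by positivity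
  -- The hypothesis `log r = O(d)` enters here: a constant factor in `B` gains a factor `4 * r` in
  -- `B ^ d`.
  have hCd : 4 * (r : ℝ) ≤ C ^ d := by
    have h1 : (r : ℝ) ≤ ((2 : ℝ) ^ A) ^ d := by
      rw [← Real.rpow_mul_natCast (by norm_num)]
      exact (Real.logb_le_iff_le_rpow (by norm_num) hr0).1 hdr
    have h2 : (4 : ℝ) ≤ 4 ^ d := le_self_pow₀ (by norm_num) (by omega)
    rw [hC, mul_pow]
    gcongr
  have hm : (r : ℝ) * d + 1 = ((r * d + 1 : ℕ) : ℝ) := by push_cast; ring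
  have hm0 : r * d + 1 ≠ 0 := by omega
  rw [hm, one_div]
  set ν : ℝ := (n.choose r : ℝ) ^ (((r * d + 1 : ℕ) : ℝ)⁻¹) with hν
  -- The choice is `Q = ⌊y⌋₊` and `B = ⌈C * r * ν⌉₊`. Since `(n / r) ^ r ≤ N`, one has `y ^ r ≤ ν`,
  -- so `Q ^ r` is at most `ν`.
  set y : ℝ := ((n : ℝ) / r) ^ (((r * d + 1 : ℕ) : ℝ)⁻¹) with hy
  have hνpow : ν ^ (r * d + 1) = n.choose r := Real.rpow_inv_natCast_pow (by linarith) hm0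
  have hypow : y ^ (r * d + 1) = (n : ℝ) / r := Real.rpow_inv_natCast_pow (by positivity) hm0
  have hν1 : 1 ≤ ν := Real.one_le_rpow hN1 (by positivity)
  have hy1 : 1 ≤ y := Real.one_le_rpow ((one_le_div hr0).2 hnr) (by positivity)
  have hyν : y ^ r ≤ ν := by
    rw [← pow_le_pow_iff_left₀ (by positivity) (by positivity) hm0, hνpow, ← pow_mul, mul_comm r,
      pow_mul, hypow, div_pow, div_le_iff₀ (by positivity), mul_comm]
    exact_mod_cast pow_le_pow_mul_choose hrn
  have hQ0 : 0 < ⌊y⌋₊ := Nat.floor_pos.2 hy1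
  have hQy : (⌊y⌋₊ : ℝ) ≤ y := Nat.floor_le (by linarith)
  have hyQ : y ≤ 2 * ⌊y⌋₊ := by
    have h1 : y < ⌊y⌋₊ + 1 := Nat.lt_floor_add_one y
    have h2 : (1 : ℝ) ≤ ⌊y⌋₊ := by exact_mod_cast hQ0
    linarith
  have hB0 : 0 < ⌈C * r * ν⌉₊ := Nat.ceil_pos.2 (by positivity)
  have hCB : C * r * ν ≤ ⌈C * r * ν⌉₊ := Nat.le_ceil _
  have hBC : (⌈C * r * ν⌉₊ : ℝ) ≤ C * r * ν + 1 := (Nat.ceil_lt_add_one (by positivity)).le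
  have hmain : 2 * (n * r ^ d) ≤ ⌊y⌋₊ * ⌈C * r * ν⌉₊ ^ d := by
    have : (2 * (n * r ^ d) : ℝ) ≤ ⌊y⌋₊ * (⌈C * r * ν⌉₊ : ℝ) ^ d := by
      calc (2 * (n * r ^ d) : ℝ) = (y / 2) * ((4 * r) * r ^ d * (y ^ r) ^ d) := by
            -- One factor `y` is paid for by `Q`, the factor `(y ^ r) ^ d ≤ ν ^ d` by `B ^ d`, and
            -- the surplus `4 * r` by `C ^ d`.
            have h1 : (n : ℝ) = r * (y * (y ^ r) ^ d) := by
              rw [← pow_mul, ← pow_succ', hypow]; field_simp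
            rw [h1]; ring
        _ ≤ ⌊y⌋₊ * (C ^ d * r ^ d * ν ^ d) := by gcongr; linarith
        _ = ⌊y⌋₊ * (C * r * ν) ^ d := by rw [mul_pow (C * r) ν, mul_pow C (r : ℝ)]
        _ ≤ _ := by gcongr
    exact_mod_cast this
  have : NeZero ⌊y⌋₊ := ⟨hQ0.ne'⟩
  obtain ⟨c, hc, hE⟩ := exists_nonadaptiveCode hrn hmain hB0 hd
  refine ⟨c, hc, hE.trans ?_⟩
  have hQr : (⌊y⌋₊ : ℝ) ^ r ≤ ν := (pow_le_pow_left₀ (by positivity) hQy r).trans hyν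
  have hrd : ν ≤ r * d * ν := le_mul_of_one_le_left (by linarith)
    (one_le_mul_of_one_le_of_one_le hr1 hd1)
  have hdle : (d : ℝ) ≤ r * d * ν := by
    calc (d : ℝ) = 1 * d * 1 := by ring
      _ ≤ r * d * ν := by gcongr
  calc (d : ℝ) * ⌈C * r * ν⌉₊ + 2 * (⌊y⌋₊ : ℝ) ^ r ≤ d * (C * r * ν + 1) + 2 * ν := by gcongr
    _ = C * (r * d * ν) + d + 2 * ν := by ring
    _ ≤ C * (r * d * ν) + r * d * ν + 2 * (r * d * ν) := by gcongr
    _ = _ := by ring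

/-! ### Combination of the two bounds. -/

/-- The two-sided bound for codes that are optimal in a class of adaptive codes containing all
non-adaptive ones. -/
theorem isTheta_expectedLength {r d : ℕ → ℕ}
    (hr : ∀ᶠ n : ℕ in atTop, 1 ≤ r n ∧ r n ≤ n)
    (hd : ∀ᶠ n : ℕ in atTop, 1 ≤ d n)
    (hlog : (fun n : ℕ => (r n : ℝ) * (d n : ℝ)) =O[atTop]
      (fun n : ℕ => Real.logb 2 (n.choose (r n) : ℝ)))
    (hdr : (fun n : ℕ => Real.logb 2 (r n : ℝ)) =O[atTop] (fun n : ℕ => (d n : ℝ)))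
    {P : (n : ℕ) → (SparseVec n (r n) → Codeword) → Prop}
    (hP : ∀ n c, P n c → IsAdaptiveCode (d n) c)
    (hP' : ∀ n c, IsNonadaptiveCode (d n) c → P n c)
    {c : (n : ℕ) → SparseVec n (r n) → Codeword}
    (hc : ∀ᶠ n : ℕ in atTop, IsOptimal (P n) (c n)) :
    (fun n : ℕ => expectedLength (c n)) =Θ[atTop]
      (fun n : ℕ => (r n : ℝ) * (d n : ℝ) *
        (n.choose (r n) : ℝ) ^ (1 / ((r n : ℝ) * (d n : ℝ) + 1))) := by
  obtain ⟨A, hA, hA'⟩ := hlog.exists_pos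
  obtain ⟨A₂, -, hA₂'⟩ := hdr.exists_pos
  constructor
  · refine IsBigO.of_bound (4 * (2 : ℝ) ^ A₂ + 3) ?_
    filter_upwards [hr, hd, hA₂'.bound, hc] with n hrn hdn hb hopt
    have hb' : Real.logb 2 (r n) ≤ A₂ * d n := by
      refine (le_abs_self _).trans (by simpa using hb)
    obtain ⟨c', hc', hE⟩ := exists_nonadaptiveCode_expectedLength_le hrn.1 hrn.2 hdn hb'
    have h1 := one_le_expectedLength hrn.2 (c n)
    rw [Real.norm_of_nonneg (by linarith), Real.norm_of_nonneg (by positivity)]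
    exact (hopt.2 c' (hP' n c' hc')).trans hE
  · refine IsBigO.of_bound (8 * (Real.exp 1 * (2 + 4 * A))) ?_
    filter_upwards [hr, hd, hA'.bound, hc] with n hrn hdn hb hopt
    have hN1 : (1 : ℝ) ≤ n.choose (r n) := by exact_mod_cast Nat.choose_pos hrn.2
    rw [Real.norm_of_nonneg (by positivity),
      Real.norm_of_nonneg (Real.logb_nonneg (by norm_num) hN1)] at hb
    have h1 := one_le_expectedLength hrn.2 (c n)
    rw [Real.norm_of_nonneg (by positivity), Real.norm_of_nonneg (by linarith)]
    exact (hP n _ hopt.1).le_expectedLength hrn.1 hrn.2 hdn hA hb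

end LocDec

theorem corollary1 (r d : ℕ → ℕ)
    (hr : ∀ᶠ n : ℕ in atTop, 1 ≤ r n ∧ r n ≤ n)
    (hd : ∀ᶠ n : ℕ in atTop, 1 ≤ d n)
    (hlog : (fun n : ℕ => (r n : ℝ) * (d n : ℝ)) =O[atTop]
      (fun n : ℕ => Real.logb 2 (n.choose (r n) : ℝ)))
    (hdr : (fun n : ℕ => Real.logb 2 (r n : ℝ)) =O[atTop] (fun n : ℕ => (d n : ℝ))) :
    (∀ c : (n : ℕ) → LocDec.SparseVec n (r n) → LocDec.Codeword,
      (∀ᶠ n : ℕ in atTop, LocDec.IsOptimal (LocDec.IsAdaptiveCode (d n)) (c n)) →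
      (fun n : ℕ => LocDec.expectedLength (c n)) =Θ[atTop]
        (fun n : ℕ => (r n : ℝ) * (d n : ℝ) *
          (n.choose (r n) : ℝ) ^ (1 / ((r n : ℝ) * (d n : ℝ) + 1)))) ∧
    (∀ c : (n : ℕ) → LocDec.SparseVec n (r n) → LocDec.Codeword,
      (∀ᶠ n : ℕ in atTop, LocDec.IsOptimal (LocDec.IsNonadaptiveCode (d n)) (c n)) →
      (fun n : ℕ => LocDec.expectedLength (c n)) =Θ[atTop]
        (fun n : ℕ => (r n : ℝ) * (d n : ℝ) *
          (n.choose (r n) : ℝ) ^ (1 / ((r n : ℝ) * (d n : ℝ) + 1)))) := by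
  exact ⟨fun _ hc => LocDec.isTheta_expectedLength hr hd hlog hdr (fun _ _ h => h)
      (fun _ _ h => h.isAdaptiveCode) hc,
    fun _ hc => LocDec.isTheta_expectedLength hr hd hlog hdr (fun _ _ h => h.isAdaptiveCode)
      (fun _ _ h => h) hc⟩
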